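/- Let $n\ge 1$ be an integer and $$F_{2n}(z)=\int_{-\infty}^{\infty}e^{-t^{2n}}e^{izt}\,dt\qquad(z\in\mathbb C),\qquad R(\sigma,w)=\operatorname{Re}F_{2n}(w-i\sigma)\qquad(\sigma,w\in\mathbb R).$$ Let $w^*\in\mathbb R$ satisfy $F_{2n}(w^*)=0$. Then: 1. $R_\sigma(0,w^*)=\int_{-\infty}^{\infty}t\,e^{-t^{2n}}\cos(w^*t)\,dt=0$, the integral being absolutely convergent. 2. $w^*$ is a simple zero of $F_{2n}$, and $R_w(0,w^*)=F_{2n}'(w^*)$ is real and nonzero. 3. The level curve $R=0$ through $w^*$ crosses the $w$-axis (the real axis of the $z$-plane) perpendicularly. Precisely, there are $\varepsilon,\delta>0$ and a $C^\infty$ function $g:(-\varepsilon,\varepsilon)\to(w^*-\delta,w^*+\delta)$ with $g(0)=w^*$ such that, for $|\sigma|<\varepsilon$ and $|w-w^*|<\delta$, $R(\sigma,w)=0$ if and only if $w=g(\sigma)$; and $\frac{dw}{d\sigma}=g'(0)=0$ at $\sigma=0$. Moreover, if $\gamma$ is a curve in $\mathbb C$, defined near $0\in\mathbb R$ and differentiable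 at $0$, with $\gamma(0)=w^*$ and $\operatorname{Re}F_{2n}(\gamma(t))=0$ for all $t$ near $0$, then $\gamma'(0)$ is orthogonal to the real axis. -/

import Mathlib

open scoped ContDiff

noncomputable section

/-- The entire function `F_{2n}(z) = ∫ e^{-t^{2n}} e^{izt} dt` (over the real line), for `n ≥ 1`. -/
def fourierExpPow (n : ℕ) (z : ℂ) : ℂ :=
  ∫ t : ℝ, Complex.exp (-(t : ℂ) ^ (2 * n)) * Complex.exp (Complex.I * z * (t : ℂ))

/-- `R(σ, w) = Re F_{2n}(w - iσ)`. -/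
def reFourierExpPow (n : ℕ) (σ w : ℝ) : ℝ :=
  (fourierExpPow n ((w : ℂ) - Complex.I * (σ : ℂ))).re

end

/-! Write F for `fourierExpPow n` and M_k for its moments, so that F^(k) = i^k M_k. Apart from
simplicity of the zero all is soft: the cosine integral is odd, F' is real on the real axis, and
once F'(w*) ≠ 0 the implicit function theorem gives a level curve of slope -R_σ/R_w = 0.

Simplicity rests on F being a locally uniform limit of real-rooted polynomials
(`isRealRootedLimit_expPowMoment`). With s = j + 1/2, the coefficient of z^(2j) in F is (√π/n) ·
(-1/4)^j/j! · Γ(s/n)/Γ(s). Without the Gamma quotient this is a Gaussian, the limit of (1 -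
z²/(4N))^N up to a constant. In Euler's products for the quotient the denominator cancels, leaving
factors s + m, and multiplying coefficients by these preserves real-rootedness.

For such limits, vanishing of f' and f'' at a real point where f ≠ 0 forces f to be constant
(`IsRealRootedLimit.eq_const`). If M_0 = M_1 = 0 at a real x, integration by parts gives M_(2n-1) =
M_(2n) = 0. Applied to the derivatives of F, the previous principle carries the vanishing down to
all lower moments, and the recursion carries it up to all higher ones. Then F = 0 identically,
contradicting F(0) > 0. -/

open Polynomial Filter Topology MeasureTheory

/-! ### Real-rooted polynomials -/

/-- Rolle: the derivative of a real polynomial with only real roots has only real roots. -/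
theorem Polynomial.Splits.derivative_of_real {p : ℝ[X]} (hp : p.Splits) :
    (derivative p).Splits := by
  rw [splits_iff_card_roots] at hp ⊢
  have h1 := card_roots_le_derivative p
  have h2 := natDegree_derivative_le p
  have h3 := card_roots' (derivative p)
  rcases Nat.eq_zero_or_pos p.natDegree with h | h
  · rw [natDegree_eq_zero] at h
    obtain ⟨c, rfl⟩ := h
    simp
  · omega

/-- The first-order operator `p ↦ X p' + (j + 1) p` preserves real-rootedness. -/
theorem Polynomial.Splits.euler_operator {p : ℝ[X]} (hp : p.Splits) (j : ℕ) :
    (X * derivative p + C ((j : ℝ) + 1) * p).Splits := by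
  -- Adjoin a root of order j + 1 at the origin, differentiate, and divide out X ^ j.
  have h : X ^ j * (X * derivative p + C ((j : ℝ) + 1) * p) = derivative (X ^ (j + 1) * p) := by
    simp [derivative_mul]
    ring
  have h2 : (derivative (X ^ (j + 1) * p)).Splits :=
    ((Splits.X_pow _).mul hp).derivative_of_real
  by_cases h0 : derivative (X ^ (j + 1) * p) = 0
  · rw [h0] at h
    rcases mul_eq_zero.1 h with h | h
    · simp at h
    · rw [h]; exact Splits.zero
  · exact h2.of_dvd h0 ⟨X ^ j, by rw [← h]; ring⟩

theorem Polynomial.coeff_euler_operator (p : ℝ[X]) (a : ℝ) (k : ℕ) :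
    (X * derivative p + C a * p).coeff k = (k + a) * p.coeff k := by
  cases k with
  | zero => simp
  | succ k =>
    rw [coeff_add, coeff_X_mul, coeff_derivative, coeff_C_mul]
    push_cast; ring

/-- Multiplier sequences `k ↦ ∏ (k + j + 1)` preserve real-rootedness. -/
theorem Polynomial.Splits.exists_coeff_eq_prod_mul {p : ℝ[X]} (hp : p.Splits) (s : Finset ℕ) :
    ∃ q : ℝ[X], q.Splits ∧ ∀ k, q.coeff k = (∏ j ∈ s, ((k : ℝ) + j + 1)) * p.coeff k := by
  induction s using Finset.induction_on with
  | empty => exact ⟨p, hp, by simp⟩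
  | insert j s hj ih =>
    obtain ⟨q, hq, h⟩ := ih
    refine ⟨_, hq.euler_operator j, fun k => ?_⟩
    rw [coeff_euler_operator, h, Finset.prod_insert hj]
    ring

/-- A growth bound for real-rooted polynomials in terms of the first three Taylor coefficients at a
real point. -/
theorem Polynomial.Splits.sq_norm_aeval_add_le {p : ℝ[X]} (hp : p.Splits) {x : ℝ}
    (hx : p.eval x ≠ 0) (z : ℂ) :
    ‖aeval ((x : ℂ) + z) p‖ ^ 2 ≤ p.eval x ^ 2 *
      Real.exp (2 * z.re * ((derivative p).eval x / p.eval x) +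
        ‖z‖ ^ 2 * (((derivative p).eval x / p.eval x) ^ 2 -
          (derivative (derivative p)).eval x / p.eval x)) := by
  obtain ⟨m, hm⟩ := splits_iff_exists_multiset.1 hp
  generalize p.leadingCoeff = c at hm
  subst hm
  clear hp
  induction m using Multiset.induction_on with
  | empty => simp
  | cons r m ih =>
    rw [Multiset.map_cons, Multiset.prod_cons,
      show C c * ((X - C r) * (m.map fun a => X - C a).prod)
        = (X - C r) * (C c * (m.map fun a => X - C a).prod) by ring] at hx ⊢
    generalize C c * (m.map fun a => X - C a).prod = q at *
    have hr : x - r ≠ 0 := by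
      intro h; apply hx; simp [h]
    have hq : q.eval x ≠ 0 := by
      intro h; apply hx; simp [h]
    -- The bound for a single linear factor is 1 + u ≤ exp u.
    have key : ‖(x : ℂ) + z - r‖ ^ 2 ≤
        (x - r) ^ 2 * Real.exp (2 * z.re * (1 / (x - r)) + ‖z‖ ^ 2 * (1 / (x - r)) ^ 2) := by
      have e : ‖(x : ℂ) + z - r‖ ^ 2 =
          (x - r) ^ 2 * (2 * z.re * (1 / (x - r)) + ‖z‖ ^ 2 * (1 / (x - r)) ^ 2 + 1) := by
        rw [← Complex.normSq_eq_norm_sq, ← Complex.normSq_eq_norm_sq, Complex.normSq_apply,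
          Complex.normSq_apply]
        simp
        field_simp
        ring
      rw [e]
      gcongr
      exact Real.add_one_le_exp _
    -- Both p'/p and (p'/p)² - p''/p are additive over factors: they are the sums of 1/(x - r) and
    -- 1/(x - r)² over the roots. So the exponents add up.
    have e1 : (derivative ((X - C r) * q)).eval x / ((X - C r) * q).eval x
        = 1 / (x - r) + (derivative q).eval x / q.eval x := by
      simp [derivative_mul]
      field_simp
      try ring
    have e2 : (derivative (derivative ((X - C r) * q))).eval x / ((X - C r) * q).eval x
        = 2 * (1 / (x - r)) * ((derivative q).eval x / q.eval x)
          + (derivative (derivative q)).eval x / q.eval x := by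
      simp [derivative_mul]
      field_simp
      ring
    rw [e1, e2]
    have h3 := mul_le_mul key (ih hq) (by positivity) (by positivity)
    calc _ = ‖(x : ℂ) + z - r‖ ^ 2 * ‖aeval ((x : ℂ) + z) q‖ ^ 2 := by
            simp [mul_pow]
      _ ≤ _ := h3
      _ = _ := by
        rw [mul_mul_mul_comm, ← Real.exp_add]
        simp only [eval_mul, eval_sub, eval_X, eval_C, mul_pow]
        congr 2
        ring

/-! ### Locally uniform limits of real-rooted polynomials -/

/-- `f` is a locally uniform limit of real polynomials all of whose roots are real. -/
def IsRealRootedLimit (f : ℂ → ℂ) : Prop :=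
  ∃ p : ℕ → ℝ[X], (∀ N, (p N).Splits) ∧
    TendstoLocallyUniformlyOn (fun N z => aeval z (p N)) f atTop Set.univ

theorem IsRealRootedLimit.differentiable {f : ℂ → ℂ} (hf : IsRealRootedLimit f) :
    Differentiable ℂ f := by
  obtain ⟨p, -, h⟩ := hf
  rw [← differentiableOn_univ]
  exact h.differentiableOn (.of_forall fun N => (p N).differentiable_aeval.differentiableOn)
    isOpen_univ

theorem tendstoLocallyUniformlyOn_aeval_derivative {f : ℂ → ℂ} {p : ℕ → ℝ[X]}
    (h : TendstoLocallyUniformlyOn (fun N z => aeval z (p N)) f atTop Set.univ) :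
    TendstoLocallyUniformlyOn (fun N z => aeval z (derivative (p N))) (deriv f) atTop Set.univ := by
  have := h.deriv (.of_forall fun N => (p N).differentiable_aeval.differentiableOn) isOpen_univ
  refine this.congr fun N z _ => ?_
  simp [Polynomial.deriv_aeval]

theorem IsRealRootedLimit.deriv {f : ℂ → ℂ} (hf : IsRealRootedLimit f) :
    IsRealRootedLimit (deriv f) := by
  obtain ⟨p, hp, h⟩ := hf
  exact ⟨fun N => derivative (p N), fun N => (hp N).derivative_of_real,
    tendstoLocallyUniformlyOn_aeval_derivative h⟩

theorem tendsto_eval_of_tendsto_aeval {p : ℕ → ℝ[X]} {x : ℝ} {y : ℂ}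
    (h : Tendsto (fun N => aeval (x : ℂ) (p N)) atTop (𝓝 y)) :
    Tendsto (fun N => (p N).eval x) atTop (𝓝 y.re) := by
  refine ((Complex.continuous_re.tendsto y).comp h).congr fun N => ?_
  have : aeval (x : ℂ) (p N) = (((p N).eval x : ℝ) : ℂ) := by
    simpa using aeval_algebraMap_apply ℂ x (p N)
  simp [this]

/-- A strict form of Laguerre's inequality: a limit of real-rooted polynomials whose first and
second derivatives vanish at a real point where the function does not is constant. -/
theorem IsRealRootedLimit.eq_const {f : ℂ → ℂ} (hf : IsRealRootedLimit f) {x : ℝ}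
    (h0 : f x ≠ 0) (h1 : _root_.deriv f x = 0) (h2 : _root_.deriv (_root_.deriv f) x = 0) (z : ℂ) :
    f z = f x := by
  have hd := hf.differentiable
  obtain ⟨p, hp, h⟩ := hf
  have t (z : ℂ) : Tendsto (fun N => aeval z (p N)) atTop (𝓝 (f z)) :=
    h.tendsto_at (Set.mem_univ z)
  have t0 := tendsto_eval_of_tendsto_aeval (t x)
  have t1 := tendsto_eval_of_tendsto_aeval
    ((tendstoLocallyUniformlyOn_aeval_derivative h).tendsto_at (Set.mem_univ (x : ℂ)))
  have t2 := tendsto_eval_of_tendsto_aeval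
    ((tendstoLocallyUniformlyOn_aeval_derivative
      (tendstoLocallyUniformlyOn_aeval_derivative h)).tendsto_at (Set.mem_univ (x : ℂ)))
  rw [h1] at t1
  rw [h2] at t2
  have him : (f x).im = 0 := by
    refine tendsto_nhds_unique ((Complex.continuous_im.tendsto _).comp (t x))
      (tendsto_const_nhds.congr fun N => ?_)
    have : aeval (x : ℂ) (p N) = (((p N).eval x : ℝ) : ℂ) := by
      simpa using aeval_algebraMap_apply ℂ x (p N)
    simp [this]
  have hre : (f x).re ≠ 0 := fun hre => h0 (Complex.ext hre him)
  -- In the limit the exponent of the growth bound vanishes, so |f| ≤ |f x| everywhere and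
  -- Liouville's theorem applies.
  refine hd.apply_eq_apply_of_bounded (isBounded_iff_forall_norm_le.2 ⟨|(f x).re|, ?_⟩) z x
  rintro _ ⟨z, rfl⟩
  rw [← sq_le_sq₀ (norm_nonneg _) (abs_nonneg _), sq_abs]
  refine le_of_tendsto_of_tendsto (((t z).norm).pow 2) (b := atTop)
    (g := fun N => (p N).eval x ^ 2 *
      Real.exp (2 * (z - x).re * ((derivative (p N)).eval x / (p N).eval x) +
        ‖z - x‖ ^ 2 * (((derivative (p N)).eval x / (p N).eval x) ^ 2 -
          (derivative (derivative (p N))).eval x / (p N).eval x))) ?_ ?_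
  · have a1 := t1.div t0 hre
    have a2 := t2.div t0 hre
    have := (t0.pow 2).mul (Real.continuous_exp.continuousAt.tendsto.comp
      ((a1.const_mul (2 * (z - x).re)).add (((a1.pow 2).sub a2).const_mul (‖z - x‖ ^ 2))))
    simpa using this
  · filter_upwards [t0.eventually_ne hre] with N hN
    simpa using (hp N).sq_norm_aeval_add_le hN (z - x)

theorem Polynomial.iteratedDeriv_aeval_real (p : ℝ[X]) (k : ℕ) :
    iteratedDeriv k (fun z : ℂ => aeval z p) = fun z => aeval z (derivative^[k] p) := by
  induction k with
  | zero => simp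
  | succ k ih =>
    rw [iteratedDeriv_succ, ih, Function.iterate_succ_apply']
    ext z
    simp

/-- Cauchy's estimate for the coefficients of a real polynomial. -/
theorem Polynomial.abs_coeff_le_of_norm_aeval_le {p : ℝ[X]} {r M : ℝ} (hr : 0 < r)
    (hM : ∀ z : ℂ, ‖z‖ = r → ‖aeval z p‖ ≤ M) (k : ℕ) : |p.coeff k| ≤ M / r ^ k := by
  have h := Complex.norm_iteratedDeriv_le_of_forall_mem_sphere_norm_le (c := 0) (R := r) (C := M)
    (f := fun z : ℂ => aeval z p) k hr p.differentiable_aeval.diffContOnCl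
    (fun z hz => hM z (by simpa using hz))
  have hk : (0 : ℝ) < k.factorial := by positivity
  rw [iteratedDeriv_aeval_real] at h
  have e : aeval (0 : ℂ) (derivative^[k] p) = ((k.factorial * p.coeff k : ℝ) : ℂ) := by
    rw [← coeff_zero_eq_aeval_zero', coeff_iterate_derivative]
    simp [Nat.descFactorial_self]
  beta_reduce at h
  rw [e, Complex.norm_real, norm_mul, Real.norm_natCast, mul_div_assoc] at h
  exact le_of_mul_le_mul_left h hk

/-- Coefficientwise limits of real-rooted polynomials are locally uniform limits. -/
theorem isRealRootedLimit_of_tendsto_coeff {p : ℕ → ℝ[X]} (hp : ∀ N, (p N).Splits) {b : ℕ → ℝ}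
    (hb : ∀ k, Tendsto (fun N => (p N).coeff k) atTop (𝓝 (b k))) (hb0 : b 0 ≠ 0) {f : ℂ → ℂ}
    (hf : ∀ z, HasSum (fun k => (b k : ℂ) * z ^ k) (f z)) : IsRealRootedLimit f := by
  refine ⟨p, hp, ?_⟩
  have e0 N : (p N).eval 0 = (p N).coeff 0 := (coeff_zero_eq_eval_zero _).symm
  have e1 N : (derivative (p N)).eval 0 = (p N).coeff 1 := by
    rw [← coeff_zero_eq_eval_zero, coeff_derivative]; simp
  have e2 N : (derivative (derivative (p N))).eval 0 = 2 * (p N).coeff 2 := by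
    rw [← coeff_zero_eq_eval_zero, coeff_derivative, coeff_derivative]; norm_num; ring
  -- locally uniform bounds from the first three coefficients
  have bound (r : ℝ) (hr : 0 < r) : ∃ M : ℝ, ∀ᶠ N in atTop, ∀ z : ℂ, ‖z‖ = r →
      ‖aeval z (p N)‖ ≤ M := by
    let G : ℕ → ℝ := fun N => (p N).coeff 0 ^ 2 *
      Real.exp (2 * r * |(p N).coeff 1 / (p N).coeff 0| +
        r ^ 2 * (((p N).coeff 1 / (p N).coeff 0) ^ 2 - 2 * (p N).coeff 2 / (p N).coeff 0))
    have a1 := (hb 1).div (hb 0) hb0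
    have a2 := ((hb 2).const_mul 2).div (hb 0) hb0
    have hG := ((hb 0).pow 2).mul (Real.continuous_exp.continuousAt.tendsto.comp
      ((a1.abs.const_mul (2 * r)).add (((a1.pow 2).sub a2).const_mul (r ^ 2))))
    obtain ⟨B, hB⟩ : ∃ B, ∀ᶠ N in atTop, G N ≤ B := by
      obtain ⟨B, hB⟩ := hG.isBoundedUnder_le
      exact ⟨B, by simpa [G] using hB⟩
    refine ⟨√B, ?_⟩
    filter_upwards [hB, (hb 0).eventually_ne hb0] with N hN h0 z hz
    refine Real.le_sqrt_of_sq_le (le_trans ?_ hN)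
    have := (hp N).sq_norm_aeval_add_le (x := 0) (by rwa [e0]) z
    rw [e0, e1, e2] at this
    simp only [Complex.ofReal_zero, zero_add] at this
    refine this.trans ?_
    simp only [G]
    rw [← hz]
    gcongr (_ ^ 2 * Real.exp (?_ + _))
    rw [mul_assoc, mul_assoc]
    refine mul_le_mul_of_nonneg_left ((le_abs_self _).trans ?_) zero_le_two
    rw [abs_mul]
    gcongr
    exact Complex.abs_re_le_norm z
  rw [tendstoLocallyUniformlyOn_iff_forall_isCompact isOpen_univ]
  rintro K - hK
  obtain ⟨R, hR0, hR⟩ : ∃ R : ℝ, 0 < R ∧ ∀ z ∈ K, ‖z‖ ≤ R := by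
    obtain ⟨R, hR⟩ := hK.isBounded.exists_norm_le
    exact ⟨max R 1, by positivity, fun z hz => (hR z hz).trans (le_max_left _ _)⟩
  -- Cauchy's estimate at radius 2R makes the terms on |z| ≤ R decay like (1/2)^k, uniformly in N;
  -- dominated convergence then sums the coefficientwise limits.
  obtain ⟨M, hM⟩ := bound (2 * R) (by positivity)
  have hcoef : ∀ᶠ N in atTop, ∀ k, |(p N).coeff k| * R ^ k ≤ M * (1 / 2) ^ k := by
    filter_upwards [hM] with N hN k
    have := abs_coeff_le_of_norm_aeval_le (by positivity) hN k
    calc _ ≤ M / (2 * R) ^ k * R ^ k := by gcongr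
      _ = _ := by rw [mul_pow, div_pow, one_pow]; field_simp
  have hbk k : |b k| * R ^ k ≤ M * (1 / 2) ^ k :=
    le_of_tendsto ((hb k).abs.mul_const (R ^ k)) (hcoef.mono fun N h => h k)
  have hsg : Summable fun k : ℕ => M * (1 / 2 : ℝ) ^ k :=
    (summable_geometric_of_lt_one (by norm_num) (by norm_num)).mul_left M
  have hbd : ∀ᶠ N in atTop, ∀ k, ‖|(p N).coeff k - b k| * R ^ k‖ ≤ 2 * (M * (1 / 2) ^ k) := by
    filter_upwards [hcoef] with N hN k
    rw [Real.norm_of_nonneg (by positivity)]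
    calc _ ≤ (|(p N).coeff k| + |b k|) * R ^ k := by gcongr; exact abs_sub _ _
      _ ≤ _ := by linarith [hN k, hbk k]
  have hlim : Tendsto (fun N => ∑' k, |(p N).coeff k - b k| * R ^ k) atTop (𝓝 0) := by
    have := tendsto_tsum_of_dominated_convergence (𝓕 := atTop)
      (f := fun N k => |(p N).coeff k - b k| * R ^ k) (g := fun _ => 0) (hsg.mul_left 2)
      (fun k => by simpa using (((hb k).sub_const (b k)).abs.mul_const (R ^ k))) hbd
    simpa using this
  rw [Metric.tendstoUniformlyOn_iff]
  intro ε hε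
  filter_upwards [hlim.eventually (gt_mem_nhds hε), hbd] with N hN hN2 z hz
  rw [dist_comm, dist_eq_norm]
  have hs : Summable fun k => |(p N).coeff k - b k| * R ^ k :=
    Summable.of_norm_bounded (hsg.mul_left 2) hN2
  have hp' : HasSum (fun k => ((p N).coeff k : ℂ) * z ^ k) (aeval z (p N)) := by
    have : aeval z (p N) = ∑ k ∈ (p N).support, ((p N).coeff k : ℂ) * z ^ k := by
      rw [aeval_def, eval₂_eq_sum, Polynomial.sum]; rfl
    rw [this]
    refine hasSum_sum_of_ne_finset_zero fun k hk => ?_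
    simp [notMem_support_iff.1 hk]
  rw [← (hp'.sub (hf z)).tsum_eq]
  refine lt_of_le_of_lt (tsum_of_norm_bounded hs.hasSum fun k => ?_) hN
  rw [← sub_mul, ← Complex.ofReal_sub, norm_mul, norm_pow, Complex.norm_real, Real.norm_eq_abs]
  gcongr
  exact hR z hz

/-! ### Moments: integrability, derivatives, recursion, values at the origin -/

/-- The moments `∫ t^k e^{-t^{2n}} e^{izt} dt`. -/
noncomputable def expPowMoment (n k : ℕ) (z : ℂ) : ℂ :=
  ∫ t : ℝ, (t : ℂ) ^ k * (Complex.exp (-(t : ℂ) ^ (2 * n)) * Complex.exp (Complex.I * z * (t : ℂ)))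

theorem fourierExpPow_eq_moment (n : ℕ) : fourierExpPow n = expPowMoment n 0 := by
  ext z; simp [fourierExpPow, expPowMoment]

theorem norm_exp_neg_pow_mul_exp (n : ℕ) (z : ℂ) (t : ℝ) :
    ‖Complex.exp (-(t : ℂ) ^ (2 * n)) * Complex.exp (Complex.I * z * (t : ℂ))‖ =
      Real.exp (-t ^ (2 * n)) * Real.exp (-z.im * t) := by
  rw [norm_mul, Complex.norm_exp, Complex.norm_exp]
  congr 2
  · norm_cast
  · simp

/-- Domination by a Gaussian: |t|^k ≤ k! e^|t|, t^(2n) ≥ t² - 1 by Bernoulli, and (1 + c)|t| ≤ t²/2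
+ (1 + c)²/2. -/
theorem integrable_abs_pow_mul_exp {n : ℕ} (hn : 1 ≤ n) (k : ℕ) (c : ℝ) :
    Integrable fun t : ℝ => |t| ^ k * (Real.exp (-t ^ (2 * n)) * Real.exp (c * |t|)) := by
  have h := (integrable_exp_neg_mul_sq (b := 1 / 2) (by norm_num)).const_mul
    (k.factorial * Real.exp (1 + (1 + c) ^ 2 / 2))
  refine h.mono' (by fun_prop) (.of_forall fun t => ?_)
  rw [Real.norm_of_nonneg (by positivity)]
  have h1 : t ^ 2 - 1 ≤ t ^ (2 * n) := by
    rw [pow_mul]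
    have := one_add_mul_sub_le_pow (a := t ^ 2) (by nlinarith [sq_nonneg t]) n
    have h2 : (1 : ℝ) ≤ n := by exact_mod_cast hn
    rcases le_total 1 (t ^ 2) with h | h
    · nlinarith
    · nlinarith [pow_nonneg (sq_nonneg t) n]
  have h2 : |t| ^ k ≤ k.factorial * Real.exp |t| := by
    have := Real.pow_div_factorial_le_exp |t| (abs_nonneg t) k
    rwa [div_le_iff₀' (by positivity)] at this
  calc _ ≤ (k.factorial * Real.exp |t|) * (Real.exp (-t ^ (2 * n)) * Real.exp (c * |t|)) := by
        gcongr
    _ = k.factorial * Real.exp (|t| + (-t ^ (2 * n) + c * |t|)) := by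
        rw [Real.exp_add, Real.exp_add]; ring
    _ ≤ k.factorial * Real.exp (1 + (1 + c) ^ 2 / 2 + -(1 / 2) * t ^ 2) := by
        refine mul_le_mul_of_nonneg_left (Real.exp_le_exp.2 ?_) (by positivity)
        nlinarith [sq_nonneg (|t| - (1 + c)), sq_abs t]
    _ = _ := by rw [Real.exp_add]; ring

theorem integrable_expPowMoment {n : ℕ} (hn : 1 ≤ n) (k : ℕ) (z : ℂ) :
    Integrable fun t : ℝ => (t : ℂ) ^ k *
      (Complex.exp (-(t : ℂ) ^ (2 * n)) * Complex.exp (Complex.I * z * (t : ℂ))) := by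
  refine (integrable_abs_pow_mul_exp hn k |z.im|).mono' (by fun_prop) (.of_forall fun t => ?_)
  rw [norm_mul, norm_exp_neg_pow_mul_exp, norm_pow, Complex.norm_real, Real.norm_eq_abs]
  gcongr |t| ^ k * (_ * ?_)
  rw [Real.exp_le_exp, ← abs_mul, ← abs_neg, ← neg_mul]
  exact le_abs_self _

theorem hasDerivAt_expPowMoment {n : ℕ} (hn : 1 ≤ n) (k : ℕ) (z : ℂ) :
    HasDerivAt (expPowMoment n k) (Complex.I * expPowMoment n (k + 1) z) z := by
  rw [expPowMoment, ← integral_const_mul]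
  refine (hasDerivAt_integral_of_dominated_loc_of_deriv_le (Metric.ball_mem_nhds z one_pos)
    (F' := fun z t => Complex.I * ((t : ℂ) ^ (k + 1) *
      (Complex.exp (-(t : ℂ) ^ (2 * n)) * Complex.exp (Complex.I * z * (t : ℂ)))))
    (bound := fun t : ℝ => |t| ^ (k + 1) * (Real.exp (-t ^ (2 * n)) *
      Real.exp ((|z.im| + 1) * |t|)))
    (.of_forall fun z => by fun_prop) (integrable_expPowMoment hn k z) (by fun_prop)
    (.of_forall fun t w hw => ?_) (integrable_abs_pow_mul_exp hn _ _)
    (.of_forall fun t w hw => ?_)).2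
  · rw [norm_mul, norm_mul, norm_exp_neg_pow_mul_exp, norm_pow, Complex.norm_real,
      Real.norm_eq_abs, Complex.norm_I, one_mul]
    gcongr |t| ^ (k + 1) * (_ * ?_)
    rw [Real.exp_le_exp]
    have h1 : |w.im| ≤ |z.im| + 1 := by
      have h2 := Complex.abs_im_le_norm (w - z)
      rw [Metric.mem_ball, dist_eq_norm] at hw
      have h3 := abs_sub_abs_le_abs_sub w.im z.im
      rw [Complex.sub_im] at h2
      linarith
    calc -w.im * t ≤ |w.im| * |t| := by
          rw [← abs_mul, ← abs_neg, ← neg_mul]; exact le_abs_self _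
      _ ≤ _ := by gcongr
  · have h1 : HasDerivAt (fun z : ℂ => Complex.I * z * (t : ℂ)) (Complex.I * t) w := by
      simpa using ((hasDerivAt_id w).const_mul Complex.I).mul_const (t : ℂ)
    refine ((h1.cexp.const_mul (Complex.exp (-(t : ℂ) ^ (2 * n)))).const_mul
      ((t : ℂ) ^ k)).congr_deriv ?_
    ring

theorem differentiable_expPowMoment {n : ℕ} (hn : 1 ≤ n) (k : ℕ) :
    Differentiable ℂ (expPowMoment n k) :=
  fun z => (hasDerivAt_expPowMoment hn k z).differentiableAt

theorem iteratedDeriv_expPowMoment_zero {n : ℕ} (hn : 1 ≤ n) (k : ℕ) :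
    iteratedDeriv k (expPowMoment n 0) = fun z => Complex.I ^ k * expPowMoment n k z := by
  induction k with
  | zero => ext z; simp
  | succ k ih =>
    rw [iteratedDeriv_succ, ih]
    ext z
    rw [((hasDerivAt_expPowMoment hn k z).const_mul _).deriv]
    ring

/-- The moment recursion obtained by integration by parts. -/
theorem expPowMoment_recursion {n : ℕ} (hn : 1 ≤ n) (k : ℕ) (z : ℂ) :
    2 * n * expPowMoment n (k + (2 * n - 1)) z =
      k * expPowMoment n (k - 1) z + Complex.I * z * expPowMoment n k z := by
  have hd (t : ℝ) : HasDerivAt (fun t : ℝ => (t : ℂ) ^ k *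
      (Complex.exp (-(t : ℂ) ^ (2 * n)) * Complex.exp (Complex.I * z * (t : ℂ))))
      (k * ((t : ℂ) ^ (k - 1) *
        (Complex.exp (-(t : ℂ) ^ (2 * n)) * Complex.exp (Complex.I * z * (t : ℂ)))) +
      Complex.I * z * ((t : ℂ) ^ k *
        (Complex.exp (-(t : ℂ) ^ (2 * n)) * Complex.exp (Complex.I * z * (t : ℂ)))) -
      2 * n * ((t : ℂ) ^ (k + (2 * n - 1)) *
        (Complex.exp (-(t : ℂ) ^ (2 * n)) * Complex.exp (Complex.I * z * (t : ℂ))))) t := by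
    -- For k = 0 the truncated exponent k - 1 is harmless, since its term carries the factor k.
    have h1 : HasDerivAt (fun w : ℂ => w ^ k) (k * (t : ℂ) ^ (k - 1)) t := hasDerivAt_pow k _
    have h2 : HasDerivAt (fun w : ℂ => -w ^ (2 * n)) (-((2 * n : ℕ) * (t : ℂ) ^ (2 * n - 1))) t :=
      (hasDerivAt_pow (2 * n) _).neg
    have h3 : HasDerivAt (fun w : ℂ => Complex.I * z * w) (Complex.I * z) t := by
      simpa using (hasDerivAt_id (t : ℂ)).const_mul (Complex.I * z)
    refine (h1.mul (h2.cexp.mul h3.cexp)).comp_ofReal.congr_deriv ?_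
    rw [pow_add]
    simp only [Pi.mul_apply]
    push_cast
    ring
  have i1 := (integrable_expPowMoment hn (k - 1) z).const_mul (k : ℂ)
  have i2 := (integrable_expPowMoment hn k z).const_mul (Complex.I * z)
  have i3 := (integrable_expPowMoment hn (k + (2 * n - 1)) z).const_mul (2 * n : ℂ)
  have := integral_eq_zero_of_hasDerivAt_of_integrable hd ((i1.add i2).sub i3)
    (integrable_expPowMoment hn k z)
  erw [integral_sub (i1.add i2) i3, integral_add i1 i2] at this
  simp only [integral_const_mul] at this
  exact (sub_eq_zero.1 this).symm

theorem expPowMoment_ofReal (n k : ℕ) (x : ℝ) : expPowMoment n k x =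
    ∫ t : ℝ, (((t ^ k * Real.exp (-t ^ (2 * n)) * Real.cos (x * t) : ℝ) : ℂ) +
      Complex.I * ((t ^ k * Real.exp (-t ^ (2 * n)) * Real.sin (x * t) : ℝ) : ℂ)) := by
  refine integral_congr_ae (.of_forall fun t => ?_)
  simp only
  rw [show Complex.I * x * t = ((x * t : ℝ) : ℂ) * Complex.I by push_cast; ring, Complex.exp_mul_I]
  push_cast
  ring

theorem integral_eq_zero_of_odd {f : ℝ → ℂ}
    (hf : ∀ t, f (-t) = -f t) : ∫ t, f t = 0 := by
  have h := integral_neg_eq_self f volume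
  simp only [hf, integral_neg] at h
  exact self_eq_neg.1 h.symm

theorem integrable_pow_mul_exp_mul_cos {n : ℕ} (hn : 1 ≤ n) (k : ℕ) (x : ℝ) :
    Integrable fun t : ℝ => t ^ k * Real.exp (-t ^ (2 * n)) * Real.cos (x * t) := by
  refine (integrable_abs_pow_mul_exp hn k 0).mono' (by fun_prop) (.of_forall fun t => ?_)
  simp only [norm_mul, norm_pow, Real.norm_eq_abs, zero_mul, Real.exp_zero, mul_one, Real.abs_exp]
  exact mul_le_of_le_one_right (by positivity) (Real.abs_cos_le_one _)

theorem integrable_pow_mul_exp_mul_sin {n : ℕ} (hn : 1 ≤ n) (k : ℕ) (x : ℝ) :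
    Integrable fun t : ℝ => t ^ k * Real.exp (-t ^ (2 * n)) * Real.sin (x * t) := by
  refine (integrable_abs_pow_mul_exp hn k 0).mono' (by fun_prop) (.of_forall fun t => ?_)
  simp only [norm_mul, norm_pow, Real.norm_eq_abs, zero_mul, Real.exp_zero, mul_one, Real.abs_exp]
  exact mul_le_of_le_one_right (by positivity) (Real.abs_sin_le_one _)

theorem expPowMoment_ofReal_eq {n : ℕ} (hn : 1 ≤ n) (k : ℕ) (x : ℝ) : expPowMoment n k x =
    ((∫ t : ℝ, t ^ k * Real.exp (-t ^ (2 * n)) * Real.cos (x * t) : ℝ) : ℂ) +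
      Complex.I * ((∫ t : ℝ, t ^ k * Real.exp (-t ^ (2 * n)) * Real.sin (x * t) : ℝ) : ℂ) := by
  rw [expPowMoment_ofReal, integral_add (integrable_pow_mul_exp_mul_cos hn k x).ofReal
    ((integrable_pow_mul_exp_mul_sin hn k x).ofReal.const_mul _), integral_const_mul,
    integral_complex_ofReal, integral_complex_ofReal]

/-- Even moments at the origin in terms of the Gamma function. -/
theorem expPowMoment_two_mul_zero {n : ℕ} (hn : 1 ≤ n) (k : ℕ) :
    expPowMoment n (2 * k) 0 = ((Real.Gamma ((k + 1 / 2) / n) / n : ℝ) : ℂ) := by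
  have h0 : (0 : ℝ) < n := by exact_mod_cast hn
  have h := expPowMoment_ofReal_eq hn (2 * k) 0
  simp only [zero_mul, Real.cos_zero, Real.sin_zero, mul_one, mul_zero, integral_zero,
    Complex.ofReal_zero, add_zero] at h
  rw [h]
  congr 1
  have e1 : (fun t : ℝ => t ^ (2 * k) * Real.exp (-t ^ (2 * n))) =
      fun t => (fun s : ℝ => s ^ (2 * k) * Real.exp (-s ^ (2 * n))) |t| := by
    ext t
    simp only [pow_mul, sq_abs]
  rw [e1, integral_comp_abs (f := fun s : ℝ => s ^ (2 * k) * Real.exp (-s ^ (2 * n)))]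
  have e2 : ∫ t in Set.Ioi (0 : ℝ), t ^ (2 * k) * Real.exp (-t ^ (2 * n)) =
      ∫ t in Set.Ioi (0 : ℝ), t ^ ((2 * k : ℕ) : ℝ) * Real.exp (-t ^ ((2 * n : ℕ) : ℝ)) := by
    simp only [Real.rpow_natCast]
  rw [e2, integral_rpow_mul_exp_neg_rpow (by positivity)
    (lt_of_lt_of_le (by norm_num) (Nat.cast_nonneg _))]
  push_cast
  rw [show ((2 : ℝ) * k + 1) / (2 * n) = (k + 1 / 2) / n by field_simp]
  field_simp

theorem expPowMoment_odd_zero {n : ℕ} (k : ℕ) : expPowMoment n (2 * k + 1) 0 = 0 := by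
  refine integral_eq_zero_of_odd fun t => ?_
  simp [pow_succ, pow_mul]

theorem hasSum_expPowMoment {n : ℕ} (hn : 1 ≤ n) (c z : ℂ) :
    HasSum (fun k : ℕ => (k.factorial : ℂ)⁻¹ * (Complex.I ^ k * expPowMoment n k c) * (z - c) ^ k)
      (expPowMoment n 0 z) := by
  have := Complex.hasSum_taylorSeries_of_entire (differentiable_expPowMoment hn 0) c z
  simp only [iteratedDeriv_expPowMoment_zero hn, smul_eq_mul] at this
  refine this.congr_fun fun k => ?_
  ring

/-! ### Gamma quotients and the approximating polynomials -/

theorem prod_range_mul_eq_prod_multiples {M : Type*} [CommMonoid M] {n : ℕ} (hn : 1 ≤ n) (N : ℕ)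
    (f : ℕ → M) : ∏ m ∈ Finset.range (n * N + 1), f m =
      (∏ i ∈ Finset.range (N + 1), f (n * i)) *
        ∏ m ∈ (Finset.range (n * N + 1)).filter (fun m => ¬ n ∣ m), f m := by
  rw [← Finset.prod_filter_mul_prod_filter_not (Finset.range (n * N + 1)) (fun m => n ∣ m)]
  congr 1
  have : (Finset.range (n * N + 1)).filter (fun m => n ∣ m) =
      (Finset.range (N + 1)).image (fun i => n * i) := by
    ext m
    simp only [Finset.mem_filter, Finset.mem_range, Finset.mem_image, Nat.lt_succ_iff]
    constructor
    · rintro ⟨h, i, rfl⟩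
      exact ⟨i, Nat.le_of_mul_le_mul_left h hn, rfl⟩
    · rintro ⟨i, hi, rfl⟩
      exact ⟨Nat.mul_le_mul_left _ hi, dvd_mul_right _ _⟩
  rw [this, Finset.prod_image]
  intro i _ j _ h
  exact Nat.eq_of_mul_eq_mul_left hn h

/-- A quotient of finite Euler products for the Gamma function is, up to geometric factors, a
polynomial: the poles of `Γ(s/n)` are cancelled by those of `Γ(s)`. -/
theorem exists_gammaSeq_div_gammaSeq_eq {n N : ℕ} (hn : 1 ≤ n) (hN : 1 ≤ N) :
    ∃ K μ : ℝ, 0 < μ ∧ ∀ j : ℕ,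
      Real.GammaSeq (((j : ℝ) + 1 / 2) / n) N / Real.GammaSeq ((j : ℝ) + 1 / 2) (n * N) =
        K * μ ^ j * ∏ m ∈ (Finset.range (n * N + 1)).filter (fun m => ¬ n ∣ m),
          ((j : ℝ) + 1 / 2 + m) := by
  have hn0 : (0 : ℝ) < n := by exact_mod_cast hn
  have hN0 : (0 : ℝ) < N := by exact_mod_cast hN
  set μ : ℝ := (N : ℝ) ^ (1 / n : ℝ) / (n * N) with hμ
  have hμ0 : 0 < μ := by positivity
  -- For s = j + 1/2, the powers N^(s/n) / (nN)^s combine to μ^s = μ^(1/2) μ^j; n^(N+1) comes from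
  -- writing s/n + i as (s + n i)/n.
  refine ⟨μ ^ (1 / 2 : ℝ) * N.factorial * n ^ (N + 1) / (n * N).factorial, μ, hμ0, fun j => ?_⟩
  set a : ℝ := (j : ℝ) + 1 / 2 with ha
  have ha0 : 0 < a := by positivity
  have h1 : (N : ℝ) ^ (a / n) = μ ^ (1 / 2 : ℝ) * μ ^ j * (n * N : ℝ) ^ a := by
    rw [← Real.rpow_natCast, mul_comm (μ ^ (1 / 2 : ℝ)), ← Real.rpow_add hμ0, ← ha, hμ,
      Real.div_rpow (by positivity) (by positivity), ← Real.rpow_mul hN0.le,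
      div_mul_cancel₀ _ (by positivity), one_div_mul_eq_div]
  have h2 : ∏ i ∈ Finset.range (N + 1), (a / n + i) =
      (∏ i ∈ Finset.range (N + 1), (a + (n * i : ℕ))) / n ^ (N + 1) := by
    rw [eq_div_iff (by positivity), ← Finset.card_range (N + 1), ← Finset.prod_const,
      Finset.card_range, ← Finset.prod_mul_distrib]
    refine Finset.prod_congr rfl fun i _ => ?_
    push_cast
    field_simp
  have h3 : 0 < ∏ i ∈ Finset.range (N + 1), (a + (n * i : ℕ)) :=
    Finset.prod_pos fun i _ => by positivity
  have h4 : 0 < ∏ m ∈ (Finset.range (n * N + 1)).filter (fun m => ¬ n ∣ m), (a + m) :=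
    Finset.prod_pos fun i _ => by positivity
  have h5 : (0 : ℝ) < (n * N : ℝ) ^ a := by positivity
  rw [Real.GammaSeq, Real.GammaSeq, prod_range_mul_eq_prod_multiples hn N (fun m => a + (m : ℝ)),
    h1, h2, Nat.cast_mul]
  field_simp

theorem tendsto_gammaSeq_div_gammaSeq {n : ℕ} (hn : 1 ≤ n) (j : ℕ) :
    Tendsto (fun N : ℕ => Real.GammaSeq (((j : ℝ) + 1 / 2) / n) N /
      Real.GammaSeq ((j : ℝ) + 1 / 2) (n * N)) atTop
      (𝓝 (Real.Gamma (((j : ℝ) + 1 / 2) / n) / Real.Gamma ((j : ℝ) + 1 / 2))) :=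
  (Real.GammaSeq_tendsto_Gamma _).div
    ((Real.GammaSeq_tendsto_Gamma _).comp (tendsto_id.const_mul_atTop' (by omega)))
    (Real.Gamma_pos_of_pos (by positivity)).ne'

/-- Legendre duplication at half-integers; it trades the 1/(2j)! of the Taylor series for the
Gaussian coefficient 1/(4^j j!) over Γ(j + 1/2). -/
theorem gamma_nat_add_half_mul_factorial (j : ℕ) :
    Real.Gamma ((j : ℝ) + 1 / 2) * j.factorial * 4 ^ j = (2 * j).factorial * √Real.pi := by
  induction j with
  | zero => simp [← Real.Gamma_one_half_eq]
  | succ j ih =>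
    rw [show ((j + 1 : ℕ) : ℝ) + 1 / 2 = ((j : ℝ) + 1 / 2) + 1 by push_cast; ring,
      Real.Gamma_add_one (by positivity), show 2 * (j + 1) = 2 * j + 1 + 1 by ring,
      Nat.factorial_succ, Nat.factorial_succ, Nat.factorial_succ, pow_succ]
    push_cast
    linear_combination 4 * ((j : ℝ) + 1 / 2) * (j + 1) * ih

/-- The polynomial is (1 - X²/N)^N, and 1 - X²/N factors over the reals. -/
theorem splits_expand_two_gaussian_approx (N : ℕ) :
    (expand ℝ 2 (((1 + X : ℝ[X]) ^ N).comp (C (-(1 / (N : ℝ))) * X))).Splits := by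
  have h : expand ℝ 2 (((1 + X : ℝ[X]) ^ N).comp (C (-(1 / (N : ℝ))) * X)) =
      ((C (-√(1 / (N : ℝ))) * X + C 1) * (C (√(1 / (N : ℝ))) * X + C 1)) ^ N := by
    have e : (C (√(1 / (N : ℝ))) : ℝ[X]) * C (√(1 / (N : ℝ))) = C (1 / (N : ℝ)) := by
      rw [← C_mul, Real.mul_self_sqrt (by positivity)]
    simp only [pow_comp, add_comp, one_comp, X_comp, map_pow, map_add, map_one, map_mul,
      expand_X, map_neg]
    rw [expand_C, ← e]
    ring
  rw [h]
  refine Splits.pow (Splits.mul ?_ ?_) N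
  · exact Splits.of_natDegree_le_one natDegree_linear_le
  · exact Splits.of_natDegree_le_one natDegree_linear_le

theorem exists_splits_coeff_eq {n N : ℕ} (hn : 1 ≤ n) (hN : 1 ≤ N) :
    ∃ p : ℝ[X], p.Splits ∧ (∀ j : ℕ, p.coeff (2 * j) =
      √Real.pi / n * (-1 / 4) ^ j * (N.choose j * (1 / (N : ℝ)) ^ j) *
        (Real.GammaSeq (((j : ℝ) + 1 / 2) / n) N / Real.GammaSeq ((j : ℝ) + 1 / 2) (n * N))) ∧
      ∀ j : ℕ, p.coeff (2 * j + 1) = 0 := by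
  obtain ⟨K, μ, hμ, h⟩ := exists_gammaSeq_div_gammaSeq_eq hn hN
  set S := (Finset.range (n * N + 1)).filter (fun m => ¬ n ∣ m) with hS
  -- Shifts by 2m are chosen because at degree 2j the multiplier 2j + 2m + 1 is 2(j + 1/2 + m).
  -- Rescaling X by √μ/2 below then supplies μ^j/4^j.
  obtain ⟨q, hq, hqc⟩ := (splits_expand_two_gaussian_approx N).exists_coeff_eq_prod_mul
    (S.image (fun m : ℕ => 2 * m))
  have hprod (j : ℕ) : ∏ m ∈ S.image (fun m : ℕ => 2 * m), (((2 * j : ℕ) : ℝ) + m + 1) =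
      2 ^ S.card * ∏ m ∈ S, ((j : ℝ) + 1 / 2 + m) := by
    rw [Finset.prod_image (fun a _ b _ h => by simpa using h), ← Finset.prod_const,
      ← Finset.prod_mul_distrib]
    refine Finset.prod_congr rfl fun m _ => ?_
    push_cast
    ring
  refine ⟨C (√Real.pi / n * K / 2 ^ S.card) * q.comp (C (√μ / 2) * X), ?_, fun j => ?_, fun j => ?_⟩
  · refine (Splits.C _).mul (hq.comp_of_natDegree_le_one ?_)
    exact (natDegree_C_mul_le _ _).trans natDegree_X_le
  · have hc : (√μ / 2) ^ (2 * j) = μ ^ j * (1 / 4) ^ j := by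
      rw [pow_mul, div_pow, Real.sq_sqrt hμ.le, ← mul_pow]; ring
    rw [coeff_C_mul, comp_C_mul_X_coeff, hqc, hprod, h, hc, coeff_expand two_pos,
      if_pos (dvd_mul_right 2 j), Nat.mul_div_cancel_left _ two_pos, comp_C_mul_X_coeff,
      coeff_one_add_X_pow]
    have e1 : (-1 / 4 : ℝ) ^ j = (-1) ^ j * (1 / 4) ^ j := by rw [← mul_pow]; ring
    have e2 : (-(1 / N : ℝ)) ^ j = (-1) ^ j * (1 / N) ^ j := by rw [← mul_pow]; ring
    rw [e1, e2]
    field_simp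
  · rw [coeff_C_mul, comp_C_mul_X_coeff, hqc, coeff_expand two_pos, if_neg (by omega)]
    simp

/-- The Fourier transform of `e^{-t^{2n}}` is a locally uniform limit of real-rooted polynomials. -/
theorem isRealRootedLimit_expPowMoment {n : ℕ} (hn : 1 ≤ n) :
    IsRealRootedLimit (expPowMoment n 0) := by
  have hn0 : (0 : ℝ) < n := by exact_mod_cast hn
  choose p hp hpe hpo using fun N : ℕ => exists_splits_coeff_eq (N := N + 1) hn (by omega)
  let b : ℕ → ℝ := fun k => if Even k then
    (-1) ^ (k / 2) / k.factorial * (Real.Gamma (((k / 2 : ℕ) + 1 / 2) / n) / n) else 0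
  have hbe (j : ℕ) : b (2 * j) =
      (-1) ^ j / (2 * j).factorial * (Real.Gamma ((j + 1 / 2) / n) / n) := by
    simp [b]
  have hbo (j : ℕ) : b (2 * j + 1) = 0 := by simp [b]
  refine isRealRootedLimit_of_tendsto_coeff hp (b := b) (fun k => ?_) ?_ fun z => ?_
  · obtain ⟨j, rfl | rfl⟩ := Nat.even_or_odd' k
    · simp only [hpe]
      -- Poisson limit: the binomial coefficient times N^(-j) tends to 1/j!.
      have h1 := ProbabilityTheory.tendsto_choose_mul_pow_atTop (p := fun n : ℕ => 1 / (n : ℝ))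
        (r := 1) j (tendsto_const_nhds.congr' (by
          filter_upwards [eventually_ge_atTop 1] with N hN
          have : (0 : ℝ) < N := by exact_mod_cast hN
          field_simp))
      have h2 := ((h1.mul (tendsto_gammaSeq_div_gammaSeq hn j)).const_mul
        (√Real.pi / n * (-1 / 4) ^ j)).comp (tendsto_add_atTop_nat 1)
      simp only [Function.comp_def, ← mul_assoc] at h2 ⊢
      convert h2 using 2
      rw [hbe]
      have h3 := gamma_nat_add_half_mul_factorial j
      have h4 : 0 < Real.Gamma ((j : ℝ) + 1 / 2) := Real.Gamma_pos_of_pos (by positivity)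
      have h5 : (-1 / 4 : ℝ) ^ j * 4 ^ j = (-1) ^ j := by rw [← mul_pow]; norm_num
      rw [← h5]
      generalize Real.Gamma ((j : ℝ) + 1 / 2) = G at *
      generalize Real.Gamma (((j : ℝ) + 1 / 2) / n) = H at *
      generalize (-1 / 4 : ℝ) ^ j = s at *
      rw [one_pow]
      field_simp
      linear_combination s * H * h3
    · simp [hpo, hbo]
  · have := hbe 0
    simp only [mul_zero] at this
    rw [this]
    have : 0 < Real.Gamma (((0 : ℕ) + 1 / 2) / n) := Real.Gamma_pos_of_pos (by positivity)
    positivity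
  · have h := hasSum_expPowMoment hn 0 z
    refine h.congr_fun fun k => ?_
    obtain ⟨j, rfl | rfl⟩ := Nat.even_or_odd' k
    · rw [hbe, expPowMoment_two_mul_zero hn, pow_mul Complex.I, Complex.I_sq]
      push_cast
      ring
    · rw [hbo, expPowMoment_odd_zero]
      simp

/-! ### Simplicity of the real zeros -/

theorem expPowMoment_two_mul_zero_ne_zero {n : ℕ} (hn : 1 ≤ n) (k : ℕ) :
    expPowMoment n (2 * k) 0 ≠ 0 := by
  rw [expPowMoment_two_mul_zero hn, Complex.ofReal_ne_zero]
  have h0 : (0 : ℝ) < n := by exact_mod_cast hn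
  have : 0 < Real.Gamma (((k : ℝ) + 1 / 2) / n) := Real.Gamma_pos_of_pos (by positivity)
  positivity

/-- These functions are the successive derivatives of F, and the class is closed under
differentiation. -/
theorem isRealRootedLimit_I_pow_mul_expPowMoment {n : ℕ} (hn : 1 ≤ n) (k : ℕ) :
    IsRealRootedLimit (fun z => Complex.I ^ k * expPowMoment n k z) := by
  induction k with
  | zero => simpa using isRealRootedLimit_expPowMoment hn
  | succ k ih =>
    convert ih.deriv using 1
    ext z
    rw [((hasDerivAt_expPowMoment hn k z).const_mul _).deriv]
    ring

/-- If two consecutive moments vanish at a real point, so does the preceding one. -/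
theorem expPowMoment_eq_zero_of_succ {n : ℕ} (hn : 1 ≤ n) {k : ℕ} {x : ℝ}
    (h1 : expPowMoment n (k + 1) x = 0) (h2 : expPowMoment n (k + 2) x = 0) :
    expPowMoment n k x = 0 := by
  by_contra h0
  have hI (j : ℕ) : Complex.I ^ j ≠ 0 := pow_ne_zero _ Complex.I_ne_zero
  have hd (j : ℕ) : deriv (fun z => Complex.I ^ j * expPowMoment n j z) =
      fun z => Complex.I ^ (j + 1) * expPowMoment n (j + 1) z := by
    ext z
    rw [((hasDerivAt_expPowMoment hn j z).const_mul _).deriv]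
    ring
  have hc := (isRealRootedLimit_I_pow_mul_expPowMoment hn k).eq_const (x := x)
    (mul_ne_zero (hI _) h0) (by simp [hd, h1]) (by simp [hd, h2])
  -- If F^(k) were constant, all later moments would vanish identically, including one of even index
  -- at the origin.
  have hz (j : ℕ) (z : ℂ) : expPowMoment n (k + j + 1) z = 0 := by
    induction j generalizing z with
    | zero =>
      have : deriv (fun z => Complex.I ^ k * expPowMoment n k z) z = 0 := by
        rw [funext hc, deriv_const]
      rw [hd] at this
      exact (mul_eq_zero.1 this).resolve_left (hI _)
    | succ j ih =>
      have := hasDerivAt_expPowMoment hn (k + j + 1) z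
      rw [funext ih] at this
      exact (mul_eq_zero.1 (this.unique (hasDerivAt_const z 0))).resolve_left Complex.I_ne_zero
  refine expPowMoment_two_mul_zero_ne_zero hn (k + 1) ?_
  rw [show 2 * (k + 1) = k + (k + 1) + 1 by ring]
  exact hz _ _

/-- The real zeros of the Fourier transform of `e^{-t^{2n}}` are simple. -/
theorem expPowMoment_one_ne_zero {n : ℕ} (hn : 1 ≤ n) {x : ℝ} (h0 : expPowMoment n 0 x = 0) :
    expPowMoment n 1 x ≠ 0 := by
  intro h1
  have hn0 : (2 * n : ℂ) ≠ 0 := by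
    have : n ≠ 0 := by omega
    simpa using this
  -- The recursion at k = 0 and k = 1 gives two consecutive vanishing moments from which to descend.
  have r0 : expPowMoment n (2 * n - 1) x = 0 := by
    have := expPowMoment_recursion hn 0 x
    rw [h0, zero_add] at this
    simpa [hn0, show n ≠ 0 by omega] using this
  have r1 : expPowMoment n (2 * n) x = 0 := by
    have := expPowMoment_recursion hn 1 x
    rw [Nat.sub_self, h0, h1, show 1 + (2 * n - 1) = 2 * n by omega] at this
    simpa [hn0, show n ≠ 0 by omega] using this
  have down (i : ℕ) (hi : i ≤ 2 * n - 1) : expPowMoment n (2 * n - 1 - i) x = 0 ∧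
      expPowMoment n (2 * n - 1 - i + 1) x = 0 := by
    induction i with
    | zero =>
      refine ⟨r0, ?_⟩
      rwa [Nat.sub_zero, Nat.sub_add_cancel (by omega)]
    | succ i ih =>
      obtain ⟨a, b⟩ := ih (by omega)
      rw [show 2 * n - 1 - i = 2 * n - 1 - (i + 1) + 1 by omega] at a b
      exact ⟨expPowMoment_eq_zero_of_succ hn a b, a⟩
  -- Up to index 2n - 1 the descent applies; beyond it the recursion expresses each moment through
  -- lower ones.
  have all (k : ℕ) : expPowMoment n k x = 0 := by
    induction k using Nat.strong_induction_on with
    | _ k ih =>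
      rcases le_total k (2 * n - 1) with hk | hk
      · have := (down (2 * n - 1 - k) (by omega)).1
        rwa [show 2 * n - 1 - (2 * n - 1 - k) = k by omega] at this
      · obtain ⟨j, rfl⟩ := Nat.exists_eq_add_of_le' hk
        have := expPowMoment_recursion hn j x
        rw [ih j (by omega), ih (j - 1) (by omega), mul_zero, mul_zero, add_zero] at this
        exact (mul_eq_zero.1 this).resolve_left hn0
  have h := hasSum_expPowMoment hn x 0
  simp only [all, mul_zero, zero_mul] at h
  exact expPowMoment_two_mul_zero_ne_zero hn 0 (h.unique hasSum_zero)

/-! ### The level curve of the real part -/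

theorem integral_odd_cos_eq_zero (n : ℕ) (x : ℝ) :
    ∫ t : ℝ, t * Real.exp (-t ^ (2 * n)) * Real.cos (x * t) = 0 := by
  have h := integral_neg_eq_self (fun t : ℝ => t * Real.exp (-t ^ (2 * n)) * Real.cos (x * t)) volume
  simp only [(even_two_mul n).neg_pow, mul_neg, Real.cos_neg, neg_mul, integral_neg] at h
  linarith

/-- At a real point the derivative of the Fourier transform is real. -/
theorem I_mul_expPowMoment_one_ofReal {n : ℕ} (hn : 1 ≤ n) (x : ℝ) :
    Complex.I * expPowMoment n 1 x =
      ((-∫ t : ℝ, t * Real.exp (-t ^ (2 * n)) * Real.sin (x * t) : ℝ) : ℂ) := by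
  have h := expPowMoment_ofReal_eq hn 1 x
  simp only [pow_one, integral_odd_cos_eq_zero] at h
  rw [h, Complex.ofReal_zero, zero_add, ← mul_assoc, Complex.I_mul_I, Complex.ofReal_neg]
  ring

/-- A zero set of the real part of a holomorphic function, near a zero on the real axis with real
nonzero derivative, is the graph of a smooth function of the imaginary coordinate. -/
theorem exists_level_curve_re_eq_zero {f : ℂ → ℂ} (hf : Differentiable ℂ f) {x r : ℝ}
    (hfx : f x = 0) (hr : r ≠ 0) (hd : HasDerivAt f (r : ℂ) x) :
    ∃ ε > (0 : ℝ), ∃ δ > (0 : ℝ), ∃ g : ℝ → ℝ,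
      ContDiffOn ℝ ∞ g (Set.Ioo (-ε) ε) ∧ g 0 = x ∧
      (∀ σ ∈ Set.Ioo (-ε) ε, g σ ∈ Set.Ioo (x - δ) (x + δ)) ∧
      (∀ σ ∈ Set.Ioo (-ε) ε, ∀ w ∈ Set.Ioo (x - δ) (x + δ),
        ((f ((w : ℂ) - Complex.I * (σ : ℂ))).re = 0 ↔ w = g σ)) ∧
      HasDerivAt g 0 0 := by
  let L : ℝ × ℝ →L[ℝ] ℂ := Complex.ofRealCLM ∘L ContinuousLinearMap.snd ℝ ℝ ℝ -
    Complex.I • (Complex.ofRealCLM ∘L ContinuousLinearMap.fst ℝ ℝ ℝ)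
  let R : ℝ × ℝ → ℝ := fun u => (f ((u.2 : ℂ) - Complex.I * (u.1 : ℂ))).re
  have hRL : R = Complex.reCLM ∘ f ∘ L := by
    ext u; simp [R, L]
  have hL0 : L (0, x) = x := by simp [L]
  -- Analyticity, rather than C^∞ at the point, is used because it propagates from a point to a
  -- neighbourhood.
  have hcd : ContDiffAt ℝ ω R (0, x) := by
    have h1 : ContDiff ℝ ω f :=
      (contDiff_iff_contDiffAt.2 fun z => ((hf.analyticAt z).contDiffAt)).restrict_scalars ℝ
    rw [hRL]
    exact (Complex.reCLM.contDiff.comp (h1.comp L.contDiff)).contDiffAt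
  have hfd : HasFDerivAt R (r • ContinuousLinearMap.snd ℝ ℝ ℝ) (0, x) := by
    have h1 : HasFDerivAt f ((ContinuousLinearMap.toSpanSingleton ℂ (r : ℂ)).restrictScalars ℝ)
        (L (0, x)) := by
      rw [hL0]; exact hd.hasFDerivAt.restrictScalars ℝ
    have h2 := Complex.reCLM.hasFDerivAt.comp (0, x) (h1.comp (0, x) L.hasFDerivAt)
    rw [hRL]
    refine h2.congr_fderiv ?_
    ext <;> simp [L]
  have hR0 : R (0, x) = 0 := by simp [R, hfx]
  have hinr : fderiv ℝ R (0, x) ∘L .inr ℝ ℝ ℝ = r • ContinuousLinearMap.id ℝ ℝ := by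
    rw [hfd.fderiv]; ext; simp
  -- The σ-derivative is Re(-i r) = 0 because r is real; hence g'(0) = 0.
  have hinl : fderiv ℝ R (0, x) ∘L .inl ℝ ℝ ℝ = 0 := by
    rw [hfd.fderiv]; ext; simp
  have hinv : (fderiv ℝ R (0, x) ∘L .inr ℝ ℝ ℝ).IsInvertible := by
    rw [hinr]
    refine ⟨ContinuousLinearEquiv.unitsEquivAut ℝ (Units.mk0 r hr), ?_⟩
    ext; simp
  have hω : (ω : WithTop ℕ∞) ≠ 0 := by simp
  set g := hcd.implicitFunction hω hinv with hg
  have hg0 : g 0 = x := hcd.implicitFunction_apply_self hω hinv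
  have hgd : HasDerivAt g 0 0 := by
    have h := (hcd.hasStrictFDerivAt_implicitFunction hω hinv).hasFDerivAt.hasDerivAt
    rw [hinl] at h
    simpa using h
  have hgs : ∀ᶠ σ in 𝓝 (0 : ℝ), ContDiffAt ℝ ω g σ :=
    (hcd.contDiffAt_implicitFunction hω hinv).eventually (by simp)
  have hiff : ∀ᶠ v in 𝓝 ((0 : ℝ), x), R v = 0 ↔ g v.1 = v.2 := by
    simpa only [hR0] using hcd.eventually_apply_eq_iff_implicitFunction hω hinv
  rw [nhds_prod_eq, Filter.eventually_prod_iff] at hiff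
  obtain ⟨pa, hpa, pb, hpb, hiff⟩ := hiff
  obtain ⟨δ, hδ, hδb⟩ := Metric.eventually_nhds_iff_ball.1 hpb
  have hgc : ∀ᶠ σ in 𝓝 (0 : ℝ), g σ ∈ Metric.ball x δ := by
    have := hgd.continuousAt.tendsto
    rw [hg0] at this
    exact this (Metric.ball_mem_nhds x hδ)
  obtain ⟨ε, hε, hεb⟩ := Metric.eventually_nhds_iff_ball.1 (hpa.and (hgs.and hgc))
  simp only [Real.ball_eq_Ioo, zero_sub, zero_add] at hεb hδb
  refine ⟨ε, hε, δ, hδ, g, fun σ hσ => ?_, hg0, fun σ hσ => (hεb σ hσ).2.2,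
    fun σ hσ w hw => ?_, hgd⟩
  · exact ((hεb σ hσ).2.1.of_le le_top).contDiffWithinAt
  · exact (hiff (hεb σ hσ).1 (hδb w hw)).trans eq_comm

/-- The chain rule gives (i M_1)(-i) = M_1, whose real part at a real point is the cosine integral.
-/
theorem hasDerivAt_reFourierExpPow_zero {n : ℕ} (hn : 1 ≤ n) (x : ℝ) :
    HasDerivAt (fun σ : ℝ => reFourierExpPow n σ x)
      (∫ t : ℝ, t * Real.exp (-t ^ (2 * n)) * Real.cos (x * t)) 0 := by
  have h1 : HasDerivAt (fun z : ℂ => fourierExpPow n ((x : ℂ) - Complex.I * z))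
      (expPowMoment n 1 x) ((0 : ℝ) : ℂ) := by
    have h2 : HasDerivAt (fun z : ℂ => (x : ℂ) - Complex.I * z) (-Complex.I) ((0 : ℝ) : ℂ) := by
      simpa using ((hasDerivAt_id ((0 : ℝ) : ℂ)).const_mul Complex.I).const_sub (x : ℂ)
    have h3 : HasDerivAt (fourierExpPow n) (Complex.I * expPowMoment n 1 x)
        ((x : ℂ) - Complex.I * ((0 : ℝ) : ℂ)) := by
      rw [fourierExpPow_eq_moment, Complex.ofReal_zero, mul_zero, sub_zero]
      exact hasDerivAt_expPowMoment hn 0 x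
    refine (HasDerivAt.comp ((0 : ℝ) : ℂ) h3 h2).congr_deriv ?_
    linear_combination (-expPowMoment n 1 x) * Complex.I_mul_I
  refine h1.real_of_complex.congr_deriv ?_
  rw [expPowMoment_ofReal_eq hn]
  simp

theorem mainTheorem4 (n : ℕ) (hn : 1 ≤ n) (w₀ : ℝ) (hw₀ : fourierExpPow n (w₀ : ℂ) = 0) :
    -- `R_σ(0, w₀)` exists, is given by the integral of an odd integrable function, and vanishes
    (MeasureTheory.Integrable
        (fun t : ℝ => t * Real.exp (-t ^ (2 * n)) * Real.cos (w₀ * t)) ∧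
      HasDerivAt (fun σ : ℝ => reFourierExpPow n σ w₀)
        (∫ t : ℝ, t * Real.exp (-t ^ (2 * n)) * Real.cos (w₀ * t)) 0 ∧
      (∫ t : ℝ, t * Real.exp (-t ^ (2 * n)) * Real.cos (w₀ * t)) = 0) ∧
    -- the zero is simple, and `R_w(0, w₀) = F'(w₀)` is nonzero
    analyticOrderAt (fourierExpPow n) (w₀ : ℂ) = 1 ∧
    (∃ r : ℝ, r ≠ 0 ∧
      HasDerivAt (fun w : ℝ => reFourierExpPow n 0 w) r w₀ ∧
      HasDerivAt (fourierExpPow n) (r : ℂ) (w₀ : ℂ)) ∧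
    -- near `(0, w₀)` the level set `R = 0` is one smooth curve `w = g(σ)`, with `dw/dσ = 0` at `σ = 0`
    (∃ ε > (0 : ℝ), ∃ δ > (0 : ℝ), ∃ g : ℝ → ℝ,
      ContDiffOn ℝ ∞ g (Set.Ioo (-ε) ε) ∧ g 0 = w₀ ∧
      (∀ σ ∈ Set.Ioo (-ε) ε, g σ ∈ Set.Ioo (w₀ - δ) (w₀ + δ)) ∧
      (∀ σ ∈ Set.Ioo (-ε) ε, ∀ w ∈ Set.Ioo (w₀ - δ) (w₀ + δ),
        (reFourierExpPow n σ w = 0 ↔ w = g σ)) ∧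
      HasDerivAt g 0 0) ∧
    -- every velocity at `w₀` of a curve in the set `Re F = 0` is perpendicular to the real axis
    (∀ (γ : ℝ → ℂ) (v : ℂ), γ 0 = (w₀ : ℂ) → HasDerivAt γ v 0 →
      (∀ᶠ t in nhds (0 : ℝ), (fourierExpPow n (γ t)).re = 0) →
      inner ℝ v (1 : ℂ) = 0) := by
  have hF := fourierExpPow_eq_moment n
  have hdF : Differentiable ℂ (fourierExpPow n) := hF ▸ differentiable_expPowMoment hn 0
  have h1 : expPowMoment n 1 w₀ ≠ 0 := expPowMoment_one_ne_zero hn (by rw [← hF, hw₀])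
  obtain ⟨r, hr⟩ : ∃ r : ℝ, Complex.I * expPowMoment n 1 w₀ = r :=
    ⟨_, I_mul_expPowMoment_one_ofReal hn w₀⟩
  have hd : HasDerivAt (fourierExpPow n) (r : ℂ) (w₀ : ℂ) := by
    rw [hF, ← hr]; exact hasDerivAt_expPowMoment hn 0 w₀
  have hr0 : r ≠ 0 := by
    rintro rfl
    exact mul_ne_zero Complex.I_ne_zero h1 hr
  refine ⟨⟨by simpa using integrable_pow_mul_exp_mul_cos hn 1 w₀,
    hasDerivAt_reFourierExpPow_zero hn w₀, integral_odd_cos_eq_zero n w₀⟩, ?_,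
    ⟨r, hr0, ?_, hd⟩, exists_level_curve_re_eq_zero hdF hw₀ hr0 hd, ?_⟩
  · refine AnalyticAt.analyticOrderAt_eq_one_of_zero_deriv_ne_zero (hdF.analyticAt _) hw₀ ?_
    rw [hd.deriv]
    exact_mod_cast hr0
  · simpa [reFourierExpPow] using hd.real_of_complex
  · intro γ v hγ0 hγ hre
    have h2 : HasDerivAt (fun t => (fourierExpPow n (γ t)).re) ((r : ℂ) * v).re 0 :=
      Complex.reCLM.hasFDerivAt.comp_hasDerivAt 0
        (HasDerivAt.comp_of_eq (0 : ℝ) hd hγ hγ0.symm)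
    -- Differentiating Re F(γ(t)) = 0 yields r · Re v = 0 with r ≠ 0.
    have h3 := h2.unique ((hasDerivAt_const (0 : ℝ) (0 : ℝ)).congr_of_eventuallyEq hre)
    rw [Complex.re_ofReal_mul] at h3
    simpa [Complex.inner] using (mul_eq_zero.1 h3).resolve_left hr0
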